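/- Let $s$ be a finite signature consisting of unary and binary relation symbols. A \emph{binary structure} $R=(V,(\rho_i)_{i\in I})$ of signature $s$ is a (possibly empty, possibly infinite) set $V$ with one unary or binary relation $\rho_i$ on $V$ for each symbol $i\in I$. A structure embeds into $R$ if it is isomorphic to an induced substructure $R_{\restriction A}$, $A\subseteq V$. A \emph{module} of $R$ is a set $A\subseteq V$ such that for all $a,a'\in A$, all $x\in V\setminus A$ and every binary $\rho_i$ one has $x\rho_i a\Leftrightarrow x\rho_i a'$ and $a\rho_i x\Leftrightarrow a'\rho_i x$; $R$ is \emph{prime} if its only modules are $\emptyset$, the singletons and $V$. A class $\mathcal C$ of finite structures of signature $s$ is \emph{hereditary} if it contains every finite structure that embeds into a member of $\mathcal C$. A hereditary class $\mathcal C$ is \emph{minimal prime} if it contains infinitely many prime structures up to isomorphism, while every proper hereditary subclass of $\mathcal C$ contains only finitely many up to isomorphism. The \emph{age} of $R$ is the class $\mathrm{age}(R)$ of finite structures that embed into $R$, and the \emph{kernel} of $R$ is $\ker(R)=\{x\in V:\mathrm{age}(R_{\restriction V\setminus\{x\}})\neq \mathrm{age}(R)\}$. A class $\mathcal C$ is \emph{almost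 inexhaustible} if there is a structure $R$ with $\mathrm{age}(R)=\mathcal C$ and $\ker(R)$ finite. \textbf{Theorem.} Every minimal prime class $\mathcal C$ of finite binary structures of signature $s$ is almost inexhaustible. Moreover, every structure $R$ with $\mathrm{age}(R)=\mathcal C$ has a finite kernel. -/

import Mathlib

/-- A binary relational structure on the domain `V`: a family of unary relations indexed by `U`
and a family of binary relations indexed by `B`. The pair `(U, B)` plays the role of the
signature. -/
structure BinStr (U : Type*) (B : Type*) (V : Type*) where
  un : U → V → Prop
  bin : B → V → V → Prop

namespace BinStr

variable {U B V W : Type*}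

/-- `R` is isomorphic to an induced substructure of `S`. -/
def Embeds (R : BinStr U B V) (S : BinStr U B W) : Prop :=
  ∃ f : V → W, Function.Injective f ∧
    (∀ i x, R.un i x ↔ S.un i (f x)) ∧
    (∀ i x y, R.bin i x y ↔ S.bin i (f x) (f y))

/-- `R` and `S` are isomorphic. -/
def Isomorphic (R : BinStr U B V) (S : BinStr U B W) : Prop :=
  ∃ e : V ≃ W,
    (∀ i x, R.un i x ↔ S.un i (e x)) ∧
    (∀ i x y, R.bin i x y ↔ S.bin i (e x) (e y))

/-- The substructure of `R` induced on the set `A`. -/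
def restrict (R : BinStr U B V) (A : Set V) : BinStr U B A where
  un i x := R.un i x
  bin i x y := R.bin i x y

/-- Modules. Unary relations impose nothing: seen as a binary relation, a unary relation consists
of pairs `(u, u)` only, and so never relates a point of `A` to a point outside `A`. -/
def IsModule (R : BinStr U B V) (A : Set V) : Prop :=
  ∀ a ∈ A, ∀ a' ∈ A, ∀ x, x ∉ A → ∀ i,
    (R.bin i x a ↔ R.bin i x a') ∧ (R.bin i a x ↔ R.bin i a' x)

/-- A structure is prime if all its modules are trivial: empty, a singleton, or the whole domain. -/
def IsPrime (R : BinStr U B V) : Prop :=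
  ∀ A : Set V, R.IsModule A → A = ∅ ∨ (∃ x, A = {x}) ∨ A = Set.univ

end BinStr

/-- The finite binary structures of signature `(U, B)`, on the domains `Fin n`, `n ≥ 0`: every
finite structure is isomorphic to one of these. -/
abbrev FinStr (U : Type*) (B : Type*) : Type _ := Σ n : ℕ, BinStr U B (Fin n)

namespace FinStr

variable {U B : Type*}

/-- A class of finite structures is hereditary if it contains every finite structure that embeds
into one of its members (in particular, it is closed under isomorphism). -/
def Hereditary (C : Set (FinStr U B)) : Prop :=
  ∀ S T : FinStr U B, S.2.Embeds T.2 → T ∈ C → S ∈ C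

/-- The isomorphism type of a finite structure. -/
def isoType (S : FinStr U B) : Set (FinStr U B) := {T | S.2.Isomorphic T.2}

/-- The isomorphism types of the prime members of `C`. -/
def primeTypes (C : Set (FinStr U B)) : Set (Set (FinStr U B)) :=
  isoType '' {S | S ∈ C ∧ S.2.IsPrime}

/-- A hereditary class is minimal prime if it contains infinitely many prime structures (up to
isomorphism), while every proper hereditary subclass contains only finitely many. -/
def MinimalPrime (C : Set (FinStr U B)) : Prop :=
  Hereditary C ∧ (primeTypes C).Infinite ∧
    ∀ D : Set (FinStr U B), Hereditary D → D ⊂ C → (primeTypes D).Finite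

end FinStr

namespace BinStr

variable {U B V : Type*}

/-- The age of `R`: the class of finite structures that embed into `R`. -/
def age (R : BinStr U B V) : Set (FinStr U B) := {S | S.2.Embeds R}

/-- The kernel of `R`: the points whose deletion changes the age. -/
def kernel (R : BinStr U B V) : Set V := {x | (R.restrict {x}ᶜ).age ≠ R.age}

end BinStr

/-- A class of finite structures is almost inexhaustible if it is the age of some structure with
a finite kernel. -/
def FinStr.AlmostInexhaustible {U B : Type*} (C : Set (FinStr U B)) : Prop :=
  ∃ (V : Type) (R : BinStr U B V), R.age = C ∧ R.kernel.Finite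

/-! Suppose the kernel contains a point `x` and infinitely many other points `y n`. By minimality
the age of `R` without `x` has primes of bounded size. Splitting a finite set along a prime quotient
then gives, by a minimal bad sequence argument, a well-quasi-order on finite subsets avoiding `x`
with labels in a finite set (`partiallyWellOrderedOn_of_bounded_primes`). Each `y n` comes with a
finite set all of whose copies in `R` contain `y n`. Suitable labels turn an embedding between two
stages into an injection from k + 1 indices into k, a contradiction (`MinimalPrime.kernel_finite`).

A structure of age `C` exists because minimality makes `C` directed: it is an ultraproduct of a
cofinal sequence of members. -/

namespace BinStr

/-! ### Well-quasi-ordering under bounded primes -/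

variable {U B V L : Type*}

/-- The finite set `p.1`, with the labelling `p.2`, embeds into the finite set `q.1`, with the
labelling `q.2`, for the binary relations of `R`. -/
def LabelledLE (R : BinStr U B V) (p q : Finset V × (V → L)) : Prop :=
  ∃ f : V → V, (∀ a ∈ p.1, f a ∈ q.1) ∧ Set.InjOn f p.1 ∧
    (∀ i, ∀ a ∈ p.1, ∀ b ∈ p.1, (R.bin i a b ↔ R.bin i (f a) (f b))) ∧
    ∀ a ∈ p.1, q.2 (f a) = p.2 a

instance (R : BinStr U B V) : IsPreorder (Finset V × (V → L)) R.LabelledLE where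
  refl p := ⟨id, by simp [Set.injOn_id]⟩
  trans := by
    rintro p q r ⟨f, f1, f2, f3, f4⟩ ⟨g, g1, g2, g3, g4⟩
    refine ⟨g ∘ f, fun a ha => g1 _ (f1 a ha), ?_, fun i a ha b hb => ?_, fun a ha => ?_⟩
    · exact g2.comp f2 fun a ha => f1 a ha
    · exact (f3 i a ha b hb).trans (g3 i _ (f1 a ha) _ (f1 b hb))
    · exact (g4 _ (f1 a ha)).trans (f4 a ha)

/-- Base case of the decomposition: a labelled point is determined by its label and its loops, so
there are finitely many types. -/
theorem partiallyWellOrderedOn_card_le_one [Finite B] [Finite L] (R : BinStr U B V) :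
    {p : Finset V × (V → L) | p.1.card ≤ 1}.PartiallyWellOrderedOn R.LabelledLE := by
  classical
  rw [Set.partiallyWellOrderedOn_iff_exists_lt]
  intro s hs
  by_cases h0 : ∃ n, (s n).1 = ∅
  · obtain ⟨n, hn⟩ := h0
    exact ⟨n, n + 1, n.lt_succ_self, id, by simp [hn]⟩
  push Not at h0
  have h1 : ∀ n, ∃ a, (s n).1 = {a} := fun n =>
    Finset.card_eq_one.1 (le_antisymm (hs n) (Finset.card_pos.2 (h0 n)))
  choose a ha using h1
  obtain ⟨m, n, hmn, h⟩ := Finite.wellQuasiOrdered (α := L × (B → Prop)) (· = ·)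
    fun n => ((s n).2 (a n), fun i => R.bin i (a n) (a n))
  obtain ⟨hl, hb⟩ := Prod.ext_iff.1 h
  refine ⟨m, n, hmn, fun _ => a n, ?_, ?_, ?_, ?_⟩
  · simp [ha]
  · simp [ha]
  · simpa [ha] using fun i => iff_of_eq (congrFun hb i)
  · simpa [ha] using hl.symm

/-- A finite set with at least two elements is the union of the fibres, all proper, of a map onto
a finite set that carries the relations between distinct fibres, provided the prime finite
subsets have bounded size. -/
theorem exists_prime_quotient (R : BinStr U B V) {N : ℕ} (A : Finset V)
    (hN : ∀ T ⊆ A, (R.restrict (T : Set V)).IsPrime → T.card ≤ N) (hA : 2 ≤ A.card) :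
    ∃ (p : V → Fin (N + 1)) (Q : B → Fin (N + 1) → Fin (N + 1) → Prop),
      (∀ a ∈ A, ∀ b ∈ A, p a ≠ p b → ∀ i, (R.bin i a b ↔ Q i (p a) (p b))) ∧
      ∀ j, ∃ a ∈ A, p a ≠ j := by
  classical
  -- Retractions of `A` onto a transversal of a partition into at least two modules. With the fewest
  -- classes, the transversal is prime.
  let Good : (V → V) → Prop := fun p => (∀ a ∈ A, p a ∈ A) ∧ (∀ a ∈ A, p (p a) = p a) ∧
    (∀ a ∈ A, ∀ b ∈ A, p a ≠ p b → ∀ i, (R.bin i a b ↔ R.bin i (p a) (p b))) ∧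
    2 ≤ (A.image p).card
  have hex : ∃ n, ∃ p, Good p ∧ (A.image p).card = n :=
    ⟨_, id, ⟨by simp, by simp, by simp, by simpa using hA⟩, rfl⟩
  obtain ⟨p, ⟨hpA, hpp, hpb, hp2⟩, hpn⟩ := Nat.find_spec hex
  have hmin : ∀ q, Good q → (A.image p).card ≤ (A.image q).card := fun q hq => by
    rw [hpn]; exact Nat.find_min' hex ⟨q, hq, rfl⟩
  set T := A.image p with hT
  have hTA : T ⊆ A := Finset.image_subset_iff.2 hpA
  have hpT : ∀ t ∈ T, p t = t := by
    intro t ht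
    obtain ⟨a, ha, rfl⟩ := Finset.mem_image.1 ht
    exact hpp a ha
  have hprime : (R.restrict (T : Set V)).IsPrime := by
    intro M hM
    by_contra hcon
    push Not at hcon
    obtain ⟨⟨t, htM⟩, hsing, huniv⟩ := hcon
    obtain ⟨u, huM, hut⟩ : ∃ u ∈ M, u ≠ t := by
      by_contra h
      push Not at h
      exact hsing t (Set.eq_singleton_iff_unique_mem.2 ⟨htM, h⟩)
    obtain ⟨w, hw⟩ := (Set.ne_univ_iff_exists_notMem M).1 huniv
    let M' : Set V := Subtype.val '' M
    have hM'T : ∀ v ∈ M', v ∈ T := by rintro _ ⟨v, -, rfl⟩; exact v.2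
    have htM' : t.1 ∈ M' := ⟨t, htM, rfl⟩
    have hmod : ∀ a ∈ M', ∀ x ∈ T, x ∉ M' → ∀ i,
        (R.bin i x a ↔ R.bin i x t) ∧ (R.bin i a x ↔ R.bin i t x) := by
      rintro _ ⟨a, ha, rfl⟩ x hx hxM i
      exact hM a ha t htM ⟨x, hx⟩ (fun h => hxM ⟨_, h, rfl⟩) i
    let q : V → V := fun a => if p a ∈ M' then t else p a
    have hq1 : ∀ a, p a ∈ M' → q a = t := fun a h => if_pos h
    have hq2 : ∀ a, p a ∉ M' → q a = p a := fun a h => if_neg h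
    have hpmem : ∀ a ∈ A, p a ∈ T := fun a ha => Finset.mem_image_of_mem p ha
    have hqT : ∀ a ∈ A, q a ∈ T := by
      intro a ha
      by_cases h : p a ∈ M'
      · rw [hq1 a h]; exact t.2
      · rw [hq2 a h]; exact hpmem a ha
    have htq : q t = t := hq1 _ (by rw [hpT t t.2]; exact htM')
    have hwM' : w.1 ∉ M' := by
      rintro ⟨v, hv, hvw⟩
      exact hw (Subtype.ext hvw ▸ hv)
    have hwq : q w = w := by
      have : p w = w := hpT w w.2
      rw [hq2 _ (by rwa [this]), this]
    have hgood : Good q := by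
      refine ⟨fun a ha => hTA (hqT a ha), fun a ha => ?_, fun a ha b hb hab i => ?_, ?_⟩
      · by_cases h : p a ∈ M'
        · rw [hq1 a h, htq]
        · rw [hq2 a h, hq2 _ (by rwa [hpp a ha]), hpp a ha]
      · have hne : p a ≠ p b := fun h => hab (by simp only [q, h])
        rw [hpb a ha b hb hne i]
        by_cases h : p a ∈ M' <;> by_cases h' : p b ∈ M'
        · exact absurd ((hq1 a h).trans (hq1 b h').symm) hab
        · rw [hq1 a h, hq2 b h']
          exact (hmod _ h _ (hpmem b hb) h' i).2
        · rw [hq2 a h, hq1 b h']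
          exact (hmod _ h' _ (hpmem a ha) h i).1
        · rw [hq2 a h, hq2 b h']
      · refine Finset.one_lt_card.2 ⟨t, ?_, w, ?_, fun h => hwM' (h ▸ htM')⟩
        · exact Finset.mem_image.2 ⟨t, hTA t.2, htq⟩
        · exact Finset.mem_image.2 ⟨w, hTA w.2, hwq⟩
    refine (hmin q hgood).not_gt (Finset.card_lt_card ⟨Finset.image_subset_iff.2 hqT, fun h => ?_⟩)
    obtain ⟨a, ha, hau⟩ := Finset.mem_image.1 (h u.2)
    by_cases h : p a ∈ M'
    · rw [hq1 a h] at hau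
      exact hut (Subtype.ext hau.symm)
    · rw [hq2 a h] at hau
      exact h (hau ▸ ⟨u, huM, rfl⟩)
  have hcard : T.card ≤ N + 1 := (hN T hTA hprime).trans N.le_succ
  obtain ⟨e⟩ : Nonempty (T ↪ Fin (N + 1)) :=
    Function.Embedding.nonempty_of_card_le (by simpa using hcard)
  -- `N + 1` rather than `N` makes room for the default value 0.
  let P : V → Fin (N + 1) := fun a => if h : p a ∈ T then e ⟨p a, h⟩ else 0
  have hP : ∀ a (ha : a ∈ A), P a = e ⟨p a, Finset.mem_image_of_mem p ha⟩ := fun a ha =>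
    dif_pos _
  have hPiff : ∀ a ∈ A, ∀ b ∈ A, (P a = P b ↔ p a = p b) := by
    intro a ha b hb
    rw [hP a ha, hP b hb, e.injective.eq_iff, Subtype.mk.injEq]
  refine ⟨P, fun i j k => ∃ x y : T, e x = j ∧ e y = k ∧ R.bin i x y, ?_, ?_⟩
  · intro a ha b hb hab i
    rw [hpb a ha b hb (fun h => hab ((hPiff a ha b hb).2 h)) i]
    constructor
    · intro h
      exact ⟨_, _, (hP a ha).symm, (hP b hb).symm, h⟩
    · rintro ⟨x, y, hx, hy, h⟩
      rw [hP a ha] at hx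
      rw [hP b hb] at hy
      rwa [e.injective hx, e.injective hy] at h
  · intro j
    obtain ⟨x, hx, y, hy, hxy⟩ := Finset.one_lt_card.1 hp2
    by_contra! h
    have h1 := h x (hTA hx)
    have h2 := h y (hTA hy)
    have := (hPiff x (hTA hx) y (hTA hy)).1 (h1.trans h2.symm)
    rw [hpT x hx, hpT y hy] at this
    exact hxy this

/-- If the prime finite subsets of `W` have bounded size, then the finite subsets of `W`, with
labels in a finite set, are well-quasi-ordered under embeddability. -/
theorem partiallyWellOrderedOn_of_bounded_primes [Finite B] [Finite L] (R : BinStr U B V) {N : ℕ}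
    (W : Set V)
    (hN : ∀ T : Finset V, (T : Set V) ⊆ W → (R.restrict (T : Set V)).IsPrime → T.card ≤ N) :
    {p : Finset V × (V → L) | (p.1 : Set V) ⊆ W}.PartiallyWellOrderedOn R.LabelledLE := by
  classical
  rw [Set.PartiallyWellOrderedOn.iff_not_exists_isMinBadSeq (fun p => p.1.card)]
  rintro ⟨s, ⟨hsW, hbad⟩, hmin⟩
  let Z : Set (Finset V × (V → L)) := {p | ∃ n, p.1 ⊂ (s n).1 ∧ p.2 = (s n).2}
  have hle : ∀ p ∈ Z, ∀ n, p.1 ⊂ (s n).1 ∧ p.2 = (s n).2 → ∀ q, R.LabelledLE q p →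
      R.LabelledLE q (s n) := by
    rintro p - n ⟨h1, h2⟩ q h
    refine _root_.trans h ⟨id, fun a ha => h1.1 ha, Set.injOn_id _, by simp, by simp [h2]⟩
  have hZ : Z.PartiallyWellOrderedOn R.LabelledLE := by
    rw [Set.PartiallyWellOrderedOn.iff_forall_not_isBadSeq]
    rintro g ⟨hgZ, hg⟩
    choose φ hφ using hgZ
    -- Starting `g` where `φ` is least, the splice of `s` below `k` with this tail is again bad,
    -- against the minimality of `s` at `k`.
    obtain ⟨n0, hn0⟩ : ∃ n0, ∀ n, φ n0 ≤ φ n :=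
      ⟨Function.argmin φ, fun n => Function.argmin_le φ n⟩
    let k := φ n0
    let t : ℕ → Finset V × (V → L) := fun m => if m < k then s m else g (n0 + (m - k))
    have ht1 : ∀ m, m < k → t m = s m := fun m h => if_pos h
    have ht2 : ∀ m, k ≤ m → t m = g (n0 + (m - k)) := fun m h => if_neg h.not_gt
    refine hmin k t (fun m hm => (ht1 m hm).symm) ?_ ⟨fun n => ?_, fun m n hmn => ?_⟩
    · rw [ht2 k le_rfl]
      simpa [k] using Finset.card_lt_card (hφ n0).1
    · rcases lt_or_ge n k with h | h
      · rw [ht1 n h]; exact hsW n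
      · rw [ht2 n h]
        exact fun a ha => hsW _ ((hφ (n0 + (n - k))).1.1 ha)
    · rcases lt_or_ge n k with h | h
      · rw [ht1 n h, ht1 m (hmn.trans h)]
        exact hbad m n hmn
      · rw [ht2 n h]
        rcases lt_or_ge m k with h' | h'
        · rw [ht1 m h']
          intro hr
          exact hbad m _ (h'.trans_le (hn0 _)) (hle _ ⟨_, hφ _⟩ _ (hφ (n0 + (n - k))) _ hr)
        · rw [ht2 m h']
          exact hg _ _ (by omega)
  have hZ' := hZ.union (R.partiallyWellOrderedOn_card_le_one (L := L))
  have hdec : ∀ n, ∃ (p : V → Fin (N + 1)) (Q : B → Fin (N + 1) → Fin (N + 1) → Prop),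
      (∀ a ∈ (s n).1, ∀ b ∈ (s n).1, p a ≠ p b → ∀ i, (R.bin i a b ↔ Q i (p a) (p b))) ∧
      ∀ j, ((s n).1.filter (p · = j), (s n).2) ∈
        Z ∪ {p : Finset V × (V → L) | p.1.card ≤ 1} := by
    intro n
    rcases lt_or_ge (s n).1.card 2 with h | h
    · refine ⟨fun _ => 0, fun _ _ _ => True, by simp, fun j => Or.inr ?_⟩
      exact (Finset.card_filter_le _ _).trans (Nat.le_of_lt_succ h)
    · obtain ⟨p, Q, h1, h2⟩ := R.exists_prime_quotient (s n).1
        (fun T hT => hN T fun a ha => hsW n (hT ha)) h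
      refine ⟨p, Q, h1, fun j => Or.inl ⟨n, Finset.filter_ssubset.2 ?_, rfl⟩⟩
      simpa using h2 j
  choose p Q hpQ hpart using hdec
  have hQ : (Set.univ : Set (B → Fin (N + 1) → Fin (N + 1) → Prop)).PartiallyWellOrderedOn
      (· = ·) := Set.partiallyWellOrderedOn_univ_iff.2 (Finite.wellQuasiOrdered _)
  have hpi := Set.PartiallyWellOrderedOn.pi (ι := Fin (N + 1)) fun _ => hZ'
  -- With equal quotients, embeddings of the fibres glue to an embedding of the whole.
  obtain ⟨m, n, hmn, hQmn, hparts⟩ := (hQ.prod hpi).exists_lt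
    (f := fun n => (Q n, fun j => ((s n).1.filter (p n · = j), (s n).2)))
    fun n => ⟨trivial, fun j _ => hpart n j⟩
  refine hbad m n hmn ?_
  choose f hf1 hf2 hf3 hf4 using hparts
  dsimp only at hQmn hf1 hf2 hf3 hf4
  have hmem : ∀ a ∈ (s m).1, a ∈ (s m).1.filter (p m · = p m a) := fun a ha =>
    Finset.mem_filter.2 ⟨ha, rfl⟩
  have hfm : ∀ a ∈ (s m).1, f (p m a) a ∈ (s n).1 ∧ p n (f (p m a) a) = p m a := fun a ha =>
    Finset.mem_filter.1 (hf1 _ a (hmem a ha))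
  refine ⟨fun a => f (p m a) a, fun a ha => (hfm a ha).1, fun a ha b hb hab => ?_,
    fun i a ha b hb => ?_, fun a ha => hf4 _ a (hmem a ha)⟩
  · have hp : p m a = p m b := by
      rw [← (hfm a ha).2, ← (hfm b hb).2]; exact congrArg _ hab
    refine hf2 (p m b) (hp ▸ hmem a ha) (hmem b hb) ?_
    simpa only [hp] using hab
  · by_cases hp : p m a = p m b
    · have := hf3 (p m b) i a (hp ▸ hmem a ha) b (hmem b hb)
      simpa only [hp] using this
    · rw [hpQ m a ha b hb hp i, hpQ n _ (hfm a ha).1 _ (hfm b hb).1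
        (by rwa [(hfm a ha).2, (hfm b hb).2]) i, (hfm a ha).2, (hfm b hb).2, hQmn]

end BinStr

/-! ### Embeddings, ages and kernel points -/

namespace BinStr

variable {U B V W X : Type*}

/-- The structure induced on `W` by a map from `W` to the domain of `R`. -/
def comap (R : BinStr U B V) (f : W → V) : BinStr U B W where
  un i x := R.un i (f x)
  bin i x y := R.bin i (f x) (f y)

theorem comap_embeds (R : BinStr U B V) {f : W → V} (hf : Function.Injective f) :
    (R.comap f).Embeds R :=
  ⟨f, hf, fun _ _ => Iff.rfl, fun _ _ _ => Iff.rfl⟩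

theorem Embeds.refl (R : BinStr U B V) : R.Embeds R :=
  R.comap_embeds Function.injective_id

theorem Embeds.trans {R : BinStr U B V} {S : BinStr U B W} {T : BinStr U B X}
    (h : R.Embeds S) (h' : S.Embeds T) : R.Embeds T := by
  obtain ⟨f, f1, f2, f3⟩ := h
  obtain ⟨g, g1, g2, g3⟩ := h'
  exact ⟨g ∘ f, g1.comp f1, fun i x => (f2 i x).trans (g2 i _),
    fun i x y => (f3 i x y).trans (g3 i _ _)⟩

theorem restrict_embeds (R : BinStr U B V) (A : Set V) : (R.restrict A).Embeds R :=
  R.comap_embeds Subtype.val_injective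

theorem IsPrime.comap_equiv {R : BinStr U B V} (hR : R.IsPrime) (e : W ≃ V) :
    (R.comap e).IsPrime := by
  intro A hA
  have hM : R.IsModule (e '' A) := by
    rintro _ ⟨a, ha, rfl⟩ _ ⟨a', ha', rfl⟩ x hx i
    obtain ⟨w, rfl⟩ := e.surjective x
    exact hA a ha a' ha' w (fun h => hx ⟨w, h, rfl⟩) i
  rcases hR _ hM with h | ⟨x, h⟩ | h
  · exact Or.inl (Set.image_eq_empty.1 h)
  · refine Or.inr (Or.inl ⟨e.symm x, ?_⟩)
    rw [← e.symm_image_image A, h, Set.image_singleton]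
  · refine Or.inr (Or.inr ?_)
    rw [← e.symm_image_image A, h, Set.image_univ, e.symm.range_eq_univ]

theorem age_hereditary (R : BinStr U B V) : FinStr.Hereditary R.age :=
  fun _ _ h hT => h.trans hT

theorem age_restrict_subset (R : BinStr U B V) (A : Set V) : (R.restrict A).age ⊆ R.age :=
  fun _ h => Embeds.trans h (R.restrict_embeds A)

instance [Finite U] [Finite B] [Finite V] : Finite (BinStr U B V) :=
  Finite.of_injective (β := (U → V → Prop) × (B → V → V → Prop)) (fun R => (R.un, R.bin)) <| by
    rintro ⟨u, b⟩ ⟨u', b'⟩ h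
    cases h
    rfl

/-- A point of the kernel meets every copy in `R` of some finite subset. -/
theorem exists_finset_of_mem_kernel {R : BinStr U B V} {y : V} (hy : y ∈ R.kernel) :
    ∃ A : Finset V, ∀ f : V → V, Set.InjOn f A → (∀ i, ∀ a ∈ A, (R.un i a ↔ R.un i (f a))) →
      (∀ i, ∀ a ∈ A, ∀ b ∈ A, (R.bin i a b ↔ R.bin i (f a) (f b))) → ∃ a ∈ A, f a = y := by
  classical
  obtain ⟨S, hS, hSy⟩ : ∃ S ∈ R.age, S ∉ (R.restrict {y}ᶜ).age := by
    by_contra! h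
    exact hy (Set.Subset.antisymm (R.age_restrict_subset _) h)
  obtain ⟨g, g1, g2, g3⟩ := hS
  have hg : ∀ v, g v ∈ Finset.univ.image g := fun v => Finset.mem_image_of_mem g (Finset.mem_univ v)
  refine ⟨Finset.univ.image g, fun f f1 f2 f3 => ?_⟩
  by_contra! h
  refine hSy ⟨fun v => ⟨f (g v), h _ (hg v)⟩, fun v w hvw => ?_, fun i v => ?_, fun i v w => ?_⟩
  · exact g1 (f1 (hg v) (hg w) (congrArg Subtype.val hvw))
  · exact (g2 i v).trans (f2 i _ (hg v))
  · exact (g3 i v w).trans (f3 i _ (hg v) _ (hg w))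

end BinStr

/-! ### Finiteness of the kernel -/

namespace FinStr

variable {U B V : Type*}

theorem exists_card_le_of_finite_primeTypes {C : Set (FinStr U B)} (h : (primeTypes C).Finite) :
    ∃ N, ∀ S ∈ C, S.2.IsPrime → S.1 ≤ N := by
  have hfin : (⋃ τ ∈ primeTypes C, Sigma.fst '' τ).Finite := by
    refine h.biUnion ?_
    rintro _ ⟨S, -, rfl⟩
    refine (Set.finite_singleton S.1).subset ?_
    rintro _ ⟨T, ⟨e, -⟩, rfl⟩
    exact (Fin.equiv_iff_eq.1 ⟨e⟩).symm
  obtain ⟨N, hN⟩ := hfin.bddAbove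
  refine ⟨N, fun S hS hp => hN ?_⟩
  exact Set.mem_biUnion ⟨S, ⟨hS, hp⟩, rfl⟩ ⟨S, ⟨Equiv.refl _, by simp⟩, rfl⟩

theorem MinimalPrime.kernel_finite [Finite U] [Finite B] {C : Set (FinStr U B)}
    (hC : MinimalPrime C) (R : BinStr U B V) (hR : R.age = C) : R.kernel.Finite := by
  classical
  by_contra hK
  obtain ⟨x, hx⟩ := Set.Infinite.nonempty hK
  have hK' : (R.kernel \ {x}).Infinite := Set.Infinite.sdiff hK (Set.finite_singleton x)
  let y : ℕ → V := fun n => (hK'.natEmbedding _ n : V)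
  have hy : Function.Injective y := Subtype.val_injective.comp (hK'.natEmbedding _).injective
  have hyK : ∀ n, y n ∈ R.kernel := fun n => (hK'.natEmbedding _ n).2.1
  have hyx : ∀ n, y n ≠ x := fun n => (hK'.natEmbedding _ n).2.2
  choose A hA using fun n => BinStr.exists_finset_of_mem_kernel (hyK n)
  obtain ⟨N, hN⟩ := exists_card_le_of_finite_primeTypes
    (hC.2.2 _ (R.restrict {x}ᶜ).age_hereditary
      (hR ▸ (R.age_restrict_subset _).ssubset_of_ne hx))
  have hbound : ∀ T : Finset V, (T : Set V) ⊆ {x}ᶜ → (R.restrict (T : Set V)).IsPrime →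
      T.card ≤ N := by
    intro T hT hp
    refine hN ⟨T.card, (R.restrict (T : Set V)).comap T.equivFin.symm⟩ ?_
      (hp.comap_equiv T.equivFin.symm)
    refine ⟨fun j => ⟨T.equivFin.symm j, hT (T.equivFin.symm j).2⟩, fun j k h => ?_,
      fun _ _ => Iff.rfl, fun _ _ _ => Iff.rfl⟩
    exact T.equivFin.symm.injective (Subtype.ext (Subtype.mk.inj h))
  let D : ℕ → Finset V := fun k => (Finset.range (k + 1)).biUnion A
  -- The last three labels let an embedding extend by fixing `x`; the first two track the points `y
  -- i` and single out the last one.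
  let lab : ℕ → V → Prop × Prop × (U → Prop) × (B → Prop) × (B → Prop) := fun k v =>
    (∃ i ≤ k, v = y i, v = y k, fun i => R.un i v, fun i => R.bin i x v, fun i => R.bin i v x)
  let E : ℕ → Finset V := fun k => (D k ∪ (Finset.range (k + 1)).image y).erase x
  obtain ⟨k, l, hkl, f, f1, f2, f3, f4⟩ := (BinStr.partiallyWellOrderedOn_of_bounded_primes
    (L := Prop × Prop × (U → Prop) × (B → Prop) × (B → Prop)) R {x}ᶜ hbound).exists_lt
    (f := fun k => (E k, lab k)) (fun k v hv => (Finset.mem_erase.1 hv).1)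
  dsimp only at f1 f2 f3 f4
  simp only [lab, Prod.mk.injEq, eq_iff_iff, funext_iff] at f4
  let f' : V → V := fun v => if v = x then x else f v
  have hfx : f' x = x := if_pos rfl
  have hf' : ∀ v, v ≠ x → f' v = f v := fun v h => if_neg h
  have hDE : ∀ v ∈ D k, v ≠ x → v ∈ E k := fun v hv h =>
    Finset.mem_erase.2 ⟨h, Finset.mem_union_left _ hv⟩
  have hfne : ∀ v ∈ E k, f v ≠ x := fun v hv => (Finset.mem_erase.1 (f1 v hv)).1
  have hinj : Set.InjOn f' (D k) := by
    intro v hv w hw h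
    by_cases hvx : v = x <;> by_cases hwx : w = x
    · rw [hvx, hwx]
    · rw [hvx, hfx, hf' w hwx] at h
      exact absurd h.symm (hfne w (hDE w hw hwx))
    · rw [hwx, hfx, hf' v hvx] at h
      exact absurd h (hfne v (hDE v hv hvx))
    · rw [hf' v hvx, hf' w hwx] at h
      exact f2 (hDE v hv hvx) (hDE w hw hwx) h
  have hun : ∀ i, ∀ v ∈ D k, (R.un i v ↔ R.un i (f' v)) := by
    intro i v hv
    by_cases hvx : v = x
    · rw [hvx, hfx]
    · rw [hf' v hvx]
      exact ((f4 v (hDE v hv hvx)).2.2.1 i).symm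
  have hbin : ∀ i, ∀ v ∈ D k, ∀ w ∈ D k, (R.bin i v w ↔ R.bin i (f' v) (f' w)) := by
    intro i v hv w hw
    by_cases hvx : v = x <;> by_cases hwx : w = x
    · rw [hvx, hwx, hfx]
    · rw [hvx, hfx, hf' w hwx]
      exact ((f4 w (hDE w hw hwx)).2.2.2.1 i).symm
    · rw [hwx, hfx, hf' v hvx]
      exact ((f4 v (hDE v hv hvx)).2.2.2.2 i).symm
    · rw [hf' v hvx, hf' w hwx]
      exact f3 i v (hDE v hv hvx) w (hDE w hw hwx)
  -- The copy of `A i` must contain `y i`. Its preimage is labelled as some `y j` with `j ≤ k`, and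
  -- `j = k` would force `y i = y l`, though `i < l`.
  have hpre : ∀ i : Fin (k + 1), ∃ j : Fin k, f' (y j) = y i := by
    intro i
    have hAD : A i ⊆ D k := Finset.subset_biUnion_of_mem A (Finset.mem_range.2 i.2)
    obtain ⟨v, hv, hvi⟩ := hA i f' (hinj.mono (Finset.coe_subset.2 hAD))
      (fun j a ha => hun j a (hAD ha)) (fun j a ha b hb => hbin j a (hAD ha) b (hAD hb))
    have hvx : v ≠ x := fun h => hyx i (by rw [← hvi, h, hfx])
    have hfv : f v = y i := by rw [← hf' v hvx, hvi]
    obtain ⟨h1, h2, -⟩ := f4 v (hDE v (hAD hv) hvx)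
    have hil : (i : ℕ) < l := (Nat.lt_succ_iff.1 i.2).trans_lt hkl
    obtain ⟨j, hj, rfl⟩ := h1.1 ⟨i, hil.le, hfv⟩
    refine ⟨⟨j, hj.lt_of_ne ?_⟩, hvi⟩
    rintro rfl
    exact hil.ne (hy (hfv.symm.trans (h2.2 rfl)))
  choose σ hσ using hpre
  have hσi : Function.Injective σ := fun i j h =>
    Fin.ext (hy ((hσ i).symm.trans ((congrArg (fun t : Fin k => f' (y t)) h).trans (hσ j))))
  simpa using Fintype.card_le_of_injective σ hσi

/-! ### A structure with the given age -/

/-- A minimal prime class is directed. -/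
theorem MinimalPrime.exists_embeds {C : Set (FinStr U B)} (hC : MinimalPrime C)
    {F : Set (FinStr U B)} (hF : F.Finite) (hFC : F ⊆ C) :
    ∃ S ∈ C, ∀ T ∈ F, T.2.Embeds S.2 := by
  -- The members omitting a given `T` form a proper hereditary subclass, so some prime member of `C`
  -- omits no element of `F`.
  have hfin : (⋃ T ∈ F, primeTypes {S ∈ C | ¬T.2.Embeds S.2}).Finite := by
    refine hF.biUnion fun T hT => hC.2.2 _ ?_ ?_
    · exact fun S S' h hS' => ⟨hC.1 S S' h hS'.1, fun h' => hS'.2 (h'.trans h)⟩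
    · exact ⟨fun S hS => hS.1, fun h => (h (hFC hT)).2 (BinStr.Embeds.refl _)⟩
  obtain ⟨_, ⟨S, ⟨hSC, hSp⟩, rfl⟩, hS⟩ := hC.2.1.exists_notMem_finite hfin
  refine ⟨S, hSC, fun T hT => ?_⟩
  by_contra h
  exact hS (Set.mem_biUnion hT ⟨S, ⟨⟨hSC, h⟩, hSp⟩, rfl⟩)

/-- If every member of a hereditary class embeds into almost all terms of a sequence of nonempty
members, then the class is the age of an ultraproduct of that sequence. -/
theorem exists_age_eq [Finite U] [Finite B] {C : Set (FinStr U B)} (hC : Hereditary C)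
    (S : ℕ → FinStr U B) (hSC : ∀ k, S k ∈ C) (hpos : ∀ k, 0 < (S k).1)
    (hS : ∀ T ∈ C, ∃ j, ∀ k ≥ j, T.2.Embeds (S k).2) :
    ∃ (V : Type) (R : BinStr U B V), R.age = C := by
  classical
  let μ := Filter.hyperfilter ℕ
  let st := (μ : Filter ℕ).productSetoid fun k => Fin (S k).1
  let R : BinStr U B (Quotient st) :=
    { un := fun i v => ∀ᶠ k in μ, (S k).2.un i (v.out k)
      bin := fun i v w => ∀ᶠ k in μ, (S k).2.bin i (v.out k) (w.out k) }
  -- An atomic fact about the ultraproduct is decided the same way in almost all factors.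
  have hult : ∀ (p : Prop) (P : ℕ → Prop), (p ↔ ∀ᶠ k in μ, P k) → ∀ᶠ k in μ, (p ↔ P k) := by
    intro p P h
    by_cases hp : p
    · simpa [hp] using h.1 hp
    · have : ∀ᶠ k in μ, ¬P k := Ultrafilter.eventually_not.2 fun h' => hp (h.2 h')
      simpa [hp] using this
  refine ⟨Quotient st, R, Set.Subset.antisymm ?_ fun T hT => ?_⟩
  · rintro T ⟨f, f1, f2, f3⟩
    have e1 : ∀ᶠ k in μ, ∀ v w, v ≠ w → (f v).out k ≠ (f w).out k := by
      refine Filter.eventually_all.2 fun v => Filter.eventually_all.2 fun w => ?_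
      by_cases hvw : v = w
      · simp [hvw]
      · have : ∀ᶠ k in μ, ¬(f v).out k = (f w).out k := by
          refine Ultrafilter.eventually_not.2 fun h => hvw (f1 ?_)
          rw [← Quotient.out_eq (f v), ← Quotient.out_eq (f w)]
          exact Quotient.sound h
        simpa [hvw] using this
    have e2 : ∀ᶠ k in μ, ∀ i v, (T.2.un i v ↔ (S k).2.un i ((f v).out k)) :=
      Filter.eventually_all.2 fun i => Filter.eventually_all.2 fun v => hult _ _ (f2 i v)
    have e3 : ∀ᶠ k in μ, ∀ i v w,
        (T.2.bin i v w ↔ (S k).2.bin i ((f v).out k) ((f w).out k)) :=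
      Filter.eventually_all.2 fun i => Filter.eventually_all.2 fun v =>
        Filter.eventually_all.2 fun w => hult _ _ (f3 i v w)
    obtain ⟨k, h1, h2, h3⟩ := (e1.and (e2.and e3)).exists
    refine hC T (S k) ⟨fun v => (f v).out k, fun v w h => ?_, h2, h3⟩ (hSC k)
    by_contra hvw
    exact h1 v w hvw h
  · obtain ⟨j, hj⟩ := hS T hT
    have hg : ∀ k, ∃ g : Fin T.1 → Fin (S k).1, k ≥ j → Function.Injective g ∧
        (∀ i x, T.2.un i x ↔ (S k).2.un i (g x)) ∧
        (∀ i x y, T.2.bin i x y ↔ (S k).2.bin i (g x) (g y)) := by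
      intro k
      by_cases hk : k ≥ j
      · obtain ⟨g, h⟩ := hj k hk
        exact ⟨g, fun _ => h⟩
      · exact ⟨fun _ => ⟨0, hpos k⟩, fun h => absurd h hk⟩
    choose g hg using hg
    have hev : ∀ᶠ k in μ, k ≥ j :=
      Nat.hyperfilter_le_atTop (Filter.eventually_ge_atTop j)
    let f : Fin T.1 → Quotient st := fun v => Quotient.mk st fun k => g k v
    have hout : ∀ v, ∀ᶠ k in μ, (f v).out k = g k v := fun v =>
      Quotient.exact (Quotient.out_eq (f v))
    have hconst : ∀ (p : Prop) (P : ℕ → Prop), (∀ᶠ k in μ, (p ↔ P k)) →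
        (p ↔ ∀ᶠ k in μ, P k) := fun p P h => by
      rw [← Filter.eventually_congr h, Filter.eventually_const]
    refine ⟨f, fun v w h => ?_, fun i v => hconst _ _ ?_, fun i v w => hconst _ _ ?_⟩
    · have h' : ∀ᶠ k in μ, g k v = g k w := Quotient.exact h
      obtain ⟨k, hk, hkj⟩ := (h'.and hev).exists
      exact (hg k hkj).1 hk
    · filter_upwards [hev, hout v] with k hk hv
      rw [hv]
      exact (hg k hk).2.1 i v
    · filter_upwards [hev, hout v, hout w] with k hk hv hw
      rw [hv, hw]
      exact (hg k hk).2.2 i v w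

theorem MinimalPrime.exists_age_eq [Finite U] [Finite B] {C : Set (FinStr U B)}
    (hC : MinimalPrime C) : ∃ (V : Type) (R : BinStr U B V), R.age = C := by
  obtain ⟨T₀, hT₀, hpos⟩ : ∃ T ∈ C, 0 < T.1 := by
    by_contra! h
    refine hC.2.1 ((Set.toFinite (isoType '' Set.range (Sigma.mk 0))).subset ?_)
    rintro _ ⟨⟨n, S⟩, ⟨hS, -⟩, rfl⟩
    obtain rfl : n = 0 := Nat.le_zero.1 (h _ hS)
    exact ⟨_, ⟨S, rfl⟩, rfl⟩
  obtain ⟨T, hT⟩ := (Set.to_countable C).exists_eq_range ⟨T₀, hT₀⟩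
  have hTC : ∀ k, T k ∈ C := fun k => hT ▸ Set.mem_range_self k
  -- Including `T₀` keeps every factor nonempty.
  have hex : ∀ k, ∃ S ∈ C, ∀ T' ∈ insert T₀ (T '' Set.Iic k), T'.2.Embeds S.2 := fun k =>
    hC.exists_embeds (((Set.finite_Iic k).image T).insert T₀)
      (Set.insert_subset hT₀ (by rintro _ ⟨j, -, rfl⟩; exact hTC j))
  choose S hSC hS using hex
  refine FinStr.exists_age_eq hC.1 S hSC (fun k => ?_) fun T' hT' => ?_
  · obtain ⟨f, -⟩ := hS k T₀ (Set.mem_insert _ _)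
    exact (Nat.zero_le _).trans_lt (f ⟨0, hpos⟩).2
  · rw [hT] at hT'
    obtain ⟨j, rfl⟩ := hT'
    exact ⟨j, fun k hk => hS k _ (Set.mem_insert_of_mem _ ⟨j, hk, rfl⟩)⟩

end FinStr

theorem mainTheorem7 {U B : Type*} [Finite U] [Finite B]
    (C : Set (FinStr U B)) (hC : FinStr.MinimalPrime C) :
    FinStr.AlmostInexhaustible C ∧
      ∀ (V : Type*) (R : BinStr U B V), R.age = C → R.kernel.Finite := by
  obtain ⟨V, R, hR⟩ := hC.exists_age_eq
  exact ⟨⟨V, R, hR, hC.kernel_finite R hR⟩, fun V R hR => hC.kernel_finite R hR⟩
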